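/- Let $V$ be a (commutative) valuation domain. Let $\mathcal C_V^*$ be the class whose objects are the $V$-modules of projective dimension at most $1$. A submodule $A$ of an object $B$ is called tight in $B$ if $B/A$ has projective dimension at most $1$ (then $A$ is an object as well). A morphism of $\mathcal C_V^*$ is a $V$-homomorphism $\phi: M\to N$ between objects whose image is tight in $N$. A $V$-module $E$ is divisible if $rE=E$ for every nonzero $r\in V$. For every object $E$ of $\mathcal C_V^*$ the following conditions are equivalent: (i) $\operatorname{Ext}^1_V(C,E)=0$ for every object $C$ of $\mathcal C_V^*$; (ii) whenever $B$ is an object of $\mathcal C_V^*$ and $A$ is a tight submodule of $B$, every morphism $\phi: A\to E$ of $\mathcal C_V^*$ extends to a $V$-homomorphism $\psi: B\to E$ (not required to be a morphism of $\mathcal C_V^*$); (iii) $E$ is divisible. In other words, the objects $E$ satisfying (i), that is, the injective objects of $\mathcal C_V^*$, are exactly the divisible ones. -/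

import Mathlib

universe u

namespace TightModules

open CategoryTheory

/-- `M` is an object of the class `C_V^*`: a `V`-module of projective dimension at most `1`. -/
def IsObject (V : Type u) [CommRing V] (M : Type u) [AddCommGroup M] [Module V M] : Prop :=
  HasProjectiveDimensionLE (ModuleCat.of V M) 1

/-- The submodule `A` is tight in `B`: both `B` and `B ⧸ A` have projective dimension at
most `1`. -/
structure IsTight {V : Type u} [CommRing V] {B : Type u} [AddCommGroup B] [Module V B]
    (A : Submodule V B) : Prop where
  ambient : IsObject V B
  quotient : IsObject V (B ⧸ A)

/-- The linear map `φ` is a morphism of `C_V^*`: it is a homomorphism between objects whose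
image is tight in the codomain. -/
structure IsMorphism {V : Type u} [CommRing V] {M N : Type u} [AddCommGroup M] [Module V M]
    [AddCommGroup N] [Module V N] (φ : M →ₗ[V] N) : Prop where
  source : IsObject V M
  target : IsObject V N
  range_tight : IsTight (LinearMap.range φ)

/-- `E` is divisible: `r E = E` for every nonzero `r` in `V`. -/
def IsDivisible (V : Type u) [CommRing V] (E : Type u) [AddCommGroup E] [Module V E] : Prop :=
  ∀ r : V, r ≠ 0 → ∀ y : E, ∃ x : E, r • x = y

end TightModules

namespace TightModules

/-! ### Projectivity criteria -/

section Projective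

variable {R : Type*} [CommRing R]

/-! (i) ⇒ (ii) is the long exact Ext sequence of `A → B → B ⧸ A`. For (ii) ⇒ (iii), extend `r ↦ y`
from `rV` to `V`; the image `Vy` is tight, so (ii) applies. For (iii) ⇒ (i), write `C = F/H` with
`F` free and `H` projective; a map `H → E` must extend to `F`. If `N ≤ F` is projective and `x ∈ F`,
the conductor of `x` into `N` is principal, say `aV`, so extending to `N + Vx` amounts to solving
one equation `a • y = e`, which divisibility does. Moreover `N + Vx` is again projective, so
countably many elements can be adjoined (`conductor_principal_and_projective_sup`,
`exists_extend_sup_span_range`). Projectivity may fail in the limit. Hence Zorn's lemma is applied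
only to domains `H + F_S`, with `F_S` spanned by a saturated set `S` of basis vectors: these are
projective, and `S` can always be enlarged by countably many indices. -/

theorem projective_of_range_eq {P F : Type*} [AddCommGroup P] [Module R P] [AddCommGroup F]
    [Module R F] [Module.Projective R P] (f : P →ₗ[R] F) (hf : Function.Injective f)
    {N : Submodule R F} (hN : LinearMap.range f = N) : Module.Projective R N := by
  subst hN
  exact Module.Projective.of_equiv (LinearEquiv.ofInjective f hf)

theorem projective_ker_of_idempotent {P : Type*} [AddCommGroup P] [Module R P]
    [Module.Projective R P] (θ : P →ₗ[R] P) (hθ : ∀ x, θ (θ x) = θ x) :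
    Module.Projective R (LinearMap.ker θ) := by
  refine Module.Projective.of_split (LinearMap.ker θ).subtype
    ((LinearMap.id - θ).codRestrict (LinearMap.ker θ) fun x => by simp [hθ]) ?_
  ext x
  simp

theorem projective_of_sup_span_eq {F : Type*} [AddCommGroup F] [Module R F] {N K : Submodule R F}
    [Module.Projective R K] {x : F} (hK : ∀ t : R, t • x ∈ K → t = 0)
    (hN : K ⊔ R ∙ x = N) : Module.Projective R N := by
  refine projective_of_range_eq (K.subtype.coprod (LinearMap.toSpanSingleton R F x)) ?_ ?_
  · rw [← LinearMap.ker_eq_bot, LinearMap.ker_eq_bot']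
    rintro ⟨k, t⟩ h
    have h : (k : F) + t • x = 0 := by simpa using h
    have ht : t = 0 := hK t (by rw [← neg_eq_of_add_eq_zero_right h]; exact K.neg_mem k.2)
    subst ht
    simpa using h
  · rw [LinearMap.range_coprod, Submodule.range_subtype, LinearMap.range_toSpanSingleton, hN]

end Projective

/-! ### Adjoining elements over a valuation domain -/

section Valuation

variable {V : Type*} [CommRing V] [IsDomain V] [ValuationRing V]

theorem exists_dvd_of_nonempty {ι : Type*} (s : Finset ι) (hs : s.Nonempty) (v : ι → V) :
    ∃ i ∈ s, ∀ j ∈ s, v i ∣ v j := by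
  induction hs using Finset.Nonempty.cons_induction with
  | singleton a => exact ⟨a, by simp, by simp⟩
  | cons a s ha hs ih =>
    obtain ⟨i, his, hi⟩ := ih
    rcases ValuationRing.dvd_total (v i) (v a) with h | h
    · refine ⟨i, by simp [his], fun j hj => ?_⟩
      rcases Finset.mem_cons.1 hj with rfl | hj
      exacts [h, hi j hj]
    · refine ⟨a, by simp, fun j hj => ?_⟩
      rcases Finset.mem_cons.1 hj with rfl | hj
      exacts [dvd_rfl, h.trans (hi j hj)]

/-- A nonzero element of a projective module over a valuation domain is a multiple of an element
generating a free direct summand. -/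
theorem exists_unimodular_divisor {P : Type*} [AddCommGroup P] [Module V P]
    [Module.Projective V P] {h : P} (hh : h ≠ 0) :
    ∃ (s : V) (h' : P) (φ : P →ₗ[V] V), h = s • h' ∧ φ h' = 1 := by
  obtain ⟨e, he⟩ := Module.projective_def.1 ‹Module.Projective V P›
  have hv : e h ≠ 0 := fun h0 => hh (by rw [← he h, h0, map_zero])
  obtain ⟨i, hi, hdvd⟩ := exists_dvd_of_nonempty (e h).support
    (Finsupp.support_nonempty_iff.2 hv) (e h)
  have hi0 : e h i ≠ 0 := Finsupp.mem_support_iff.1 hi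
  have hdvd' : ∀ j, ∃ c, e h j = e h i * c := fun j => by
    by_cases hj : j ∈ (e h).support
    · exact hdvd j hj
    · exact ⟨0, by simpa using hj⟩
  choose c hc using hdvd'
  have hcs : ∀ j, c j ≠ 0 → j ∈ (e h).support := fun j hj => by
    rw [Finsupp.mem_support_iff, hc j]
    exact mul_ne_zero hi0 hj
  set w : P →₀ V := Finsupp.onFinset _ c hcs with hw
  have hsw : e h i • w = e h := by
    ext j
    simp [hw, (hc j).symm]
  have hs : h = e h i • Finsupp.linearCombination V id w := by
    rw [← map_smul, hsw, he h]
  refine ⟨e h i, Finsupp.linearCombination V id w, Finsupp.lapply i ∘ₗ e, hs, ?_⟩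
  -- A priori `w` need not lie in the range of `e`; equality holds after multiplying by `e h i`,
  -- which cancels.
  have : e (Finsupp.linearCombination V id w) = w := by
    apply smul_right_injective _ hi0
    simp only
    rw [hsw, ← map_smul, ← hs]
  rw [LinearMap.comp_apply, this, Finsupp.lapply_apply, hw, Finsupp.onFinset_apply]
  exact mul_left_cancel₀ hi0 (by rw [← hc i, mul_one])

variable {F : Type*} [AddCommGroup F] [Module V F] [Module.IsTorsionFree V F]

/-- Adjoining one element to a projective submodule of a torsion-free module over a valuation
domain: the conductor is principal and the enlarged submodule is again projective. -/
theorem conductor_principal_and_projective_sup (N : Submodule V F) [Module.Projective V N]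
    (x : F) : (∃ a : V, ∀ r : V, r • x ∈ N ↔ a ∣ r) ∧
      Module.Projective V (N ⊔ V ∙ x : Submodule V F) := by
  by_cases hx : x ∈ N
  · refine ⟨⟨1, fun r => by simpa using N.smul_mem r hx⟩, ?_⟩
    rwa [sup_eq_left.2 ((Submodule.span_singleton_le_iff_mem _ _).2 hx)]
  by_cases h0 : ∀ r : V, r • x ∈ N → r = 0
  · refine ⟨⟨0, fun r => ⟨fun h => by simp [h0 r h], fun h => ?_⟩⟩,
      projective_of_sup_span_eq h0 rfl⟩
    simp [zero_dvd_iff.1 h]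
  push Not at h0
  obtain ⟨r, hrN, hr⟩ := h0
  have hx0 : x ≠ 0 := fun h => hx (h ▸ N.zero_mem)
  obtain ⟨s, h', φ, hs, hφ⟩ := exists_unimodular_divisor (V := V) (P := N) (h := ⟨r • x, hrN⟩)
    (fun h => smul_ne_zero hr hx0 (congrArg Subtype.val h))
  have hs : r • x = s • (h' : F) := congrArg Subtype.val hs
  -- If `r ∣ s`, cancelling `r` puts `x` in `N`. Otherwise `r = s * a` and `a • x = h'`.
  rcases ValuationRing.dvd_total r s with ⟨c, rfl⟩ | ⟨a, rfl⟩
  · rw [mul_smul] at hs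
    exact absurd (smul_right_injective _ hr hs ▸ N.smul_mem c h'.2) hx
  have hs0 : s ≠ 0 := left_ne_zero_of_mul hr
  have hax : a • x = (h' : F) := by
    rw [mul_smul] at hs
    exact smul_right_injective _ hs0 hs
  have hcoef : ∀ (t : V) (n : N), t • x = n → t = a * φ n := fun t n h => by
    have : t • h' = a • n := Subtype.ext (by
      simp only [Submodule.coe_smul, ← hax, ← h]; rw [smul_comm])
    simpa [hφ] using congrArg φ this
  refine ⟨⟨a, fun t => ⟨fun h => ⟨_, hcoef t ⟨_, h⟩ rfl⟩, ?_⟩⟩, ?_⟩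
  · rintro ⟨k, rfl⟩
    rw [mul_comm, mul_smul, hax]
    exact N.smul_mem k h'.2
  -- `θ` projects `N` onto `V h'` along `ker φ`. As `h' = a • x`, adjoining `x` turns `ker φ ⊕ V h'`
  -- into `ker φ ⊕ V x`.
  set θ : N →ₗ[V] N := LinearMap.toSpanSingleton V N h' ∘ₗ φ with hθ
  have hker : ∀ n : N, n ∈ LinearMap.ker θ ↔ φ n = 0 := fun n => by
    refine ⟨fun h => ?_, fun h => by simp [hθ, h]⟩
    have := congrArg φ (LinearMap.mem_ker.1 h)
    simpa [hθ, hφ] using this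
  have := projective_ker_of_idempotent θ (fun n => by simp [hθ, hφ])
  have hK : Module.Projective V ((LinearMap.ker θ).map N.subtype) :=
    projective_of_range_eq (N.subtype ∘ₗ (LinearMap.ker θ).subtype)
      (N.injective_subtype.comp (LinearMap.ker θ).injective_subtype)
      (by rw [LinearMap.range_comp, Submodule.range_subtype])
  refine projective_of_sup_span_eq (K := (LinearMap.ker θ).map N.subtype) ?_ ?_ (x := x)
  · rintro t ⟨n, hn, hnt⟩
    rw [hcoef t n hnt.symm, (hker n).1 hn, mul_zero]
  · refine le_antisymm (sup_le_sup_right (Submodule.map_subtype_le _ _) _)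
      (sup_le (fun n hn => ?_) le_sup_right)
    have : n = (n - φ ⟨n, hn⟩ • (h' : F)) + (φ ⟨n, hn⟩ * a) • x := by
      rw [mul_smul, hax, sub_add_cancel]
    rw [this]
    refine Submodule.add_mem_sup ⟨⟨n, hn⟩ - φ ⟨n, hn⟩ • h', ?_, rfl⟩
      (Submodule.smul_mem _ _ (Submodule.mem_span_singleton_self x))
    rw [SetLike.mem_coe, hker]
    simp [hφ]

variable {E : Type*} [AddCommGroup E] [Module V E]

theorem exists_extend_sup_span (hE : ∀ r : V, r ≠ 0 → ∀ y : E, ∃ x : E, r • x = y)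
    (p : F →ₗ.[V] E) [Module.Projective V p.domain] (x : F) :
    ∃ q : F →ₗ.[V] E, p ≤ q ∧ q.domain = p.domain ⊔ V ∙ x := by
  obtain ⟨⟨a, ha⟩, -⟩ := conductor_principal_and_projective_sup p.domain x
  obtain ⟨y, hy⟩ : ∃ y : E, ∀ (r : V) (hr : r • x ∈ p.domain), p ⟨r • x, hr⟩ = r • y := by
    have hax : a • x ∈ p.domain := (ha a).2 dvd_rfl
    obtain ⟨y, hy⟩ : ∃ y : E, a • y = p ⟨a • x, hax⟩ := by
      rcases eq_or_ne a 0 with rfl | ha0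
      · refine ⟨0, ?_⟩
        rw [smul_zero, eq_comm, ← p.map_zero]
        congr 1
        exact Subtype.ext (zero_smul V x)
      · exact hE a ha0 _
    refine ⟨y, fun r hr => ?_⟩
    obtain ⟨k, rfl⟩ := (ha r).1 hr
    rw [show (a * k) • y = k • a • y by rw [smul_smul, mul_comm], hy, ← p.map_smul]
    congr 1
    exact Subtype.ext (by simp [mul_smul, mul_comm a k])
  have hH : ∀ c : V, c • x = 0 → RingHom.id V c • y = 0 := fun c hc => by
    rw [RingHom.id_apply, ← hy c (hc ▸ p.domain.zero_mem), ← p.map_zero]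
    congr 1
    exact Subtype.ext hc
  have hagree : ∀ (z : p.domain) (w : (LinearPMap.mkSpanSingleton' x y hH).domain), (z : F) = w →
      p z = LinearPMap.mkSpanSingleton' x y hH w := by
    rintro ⟨z, hz⟩ ⟨w, hw⟩ (rfl : z = w)
    obtain ⟨c, rfl⟩ := Submodule.mem_span_singleton.1 hw
    rw [LinearPMap.mkSpanSingleton'_apply, RingHom.id_apply, hy c hz]
  exact ⟨p.sup _ hagree, p.left_le_sup _ hagree, rfl⟩

/-- Each finite stage stays projective, which lets the next step proceed. Nothing is claimed for the
union, which need not be projective. -/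
theorem exists_extend_sup_span_range (hE : ∀ r : V, r ≠ 0 → ∀ y : E, ∃ x : E, r • x = y)
    (p : F →ₗ.[V] E) (hp : Module.Projective V p.domain) (f : ℕ → F) :
    ∃ q : F →ₗ.[V] E, p ≤ q ∧ q.domain = p.domain ⊔ Submodule.span V (Set.range f) := by
  have step : ∀ (q : {q : F →ₗ.[V] E // Module.Projective V q.domain}) (x : F),
      ∃ q' : {q : F →ₗ.[V] E // Module.Projective V q.domain},
        q.1 ≤ q'.1 ∧ q'.1.domain = q.1.domain ⊔ V ∙ x := by
    rintro ⟨q, hq⟩ x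
    obtain ⟨q', hle, hdom⟩ := exists_extend_sup_span hE q x
    exact ⟨⟨q', hdom ▸ (conductor_principal_and_projective_sup q.domain x).2⟩, hle, hdom⟩
  choose next hle hdom using step
  let s : ℕ → {q : F →ₗ.[V] E // Module.Projective V q.domain} :=
    fun n => Nat.rec ⟨p, hp⟩ (fun n q => next q (f n)) n
  have hs : ∀ n, s (n + 1) = next (s n) (f n) := fun n => rfl
  have hmono : Monotone fun n => (s n).1 := monotone_nat_of_le_succ fun n => hle (s n) (f n)
  have hdir : DirectedOn (· ≤ ·) (Set.range fun n => (s n).1) :=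
    directedOn_range.2 hmono.directed_le
  have hle_sSup : ∀ n, (s n).1 ≤ LinearPMap.sSup _ hdir := fun n =>
    LinearPMap.le_sSup hdir ⟨n, rfl⟩
  refine ⟨LinearPMap.sSup _ hdir, hle_sSup 0, le_antisymm ?_ (sup_le (hle_sSup 0).1 ?_)⟩
  · rw [LinearPMap.domain_sSup]
    refine sSup_le ?_
    rintro _ ⟨_, ⟨n, rfl⟩, rfl⟩
    induction n with
    | zero => exact le_sup_left
    | succ n ih =>
      simp only [hs, hdom]
      exact sup_le ih (le_sup_of_le_right (Submodule.span_mono (by simp)))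
  · rw [Submodule.span_le]
    rintro _ ⟨n, rfl⟩
    refine (hle_sSup (n + 1)).1 ?_
    rw [hs, hdom]
    exact Submodule.mem_sup_right (Submodule.mem_span_singleton_self _)

end Valuation

/-! ### Saturated submodules -/

section Saturation

variable {R : Type*} [CommRing R] {F Y : Type*} [AddCommGroup F] [Module R F]
  {H : Submodule R F}

/-- The coordinates occurring in the expansion, along `e`, of some element of `H ∩ W`. -/
def activeCoords (e : H →ₗ[R] Y →₀ R) (W : Submodule R F) : Set Y :=
  {j | ∃ h : H, (h : F) ∈ W ∧ e h j ≠ 0}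

/-- `W` contains the image under `π` of every coordinate vector occurring in `H ∩ W`. -/
def IsSaturated (e : H →ₗ[R] Y →₀ R) (π : (Y →₀ R) →ₗ[R] H) (W : Submodule R F) : Prop :=
  ∀ j ∈ activeCoords e W, (π (Finsupp.single j 1) : F) ∈ W

/-- A saturated submodule meets a projective `H` in a direct summand of `H`, so the sum of the two
is projective. -/
theorem IsSaturated.projective_sup {e : H →ₗ[R] Y →₀ R} {π : (Y →₀ R) →ₗ[R] H}
    (hπ : Function.LeftInverse π e) {W : Submodule R F} (hW : IsSaturated e π W)
    [Module.Projective R W] : Module.Projective R (H ⊔ W : Submodule R F) := by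
  classical
  have : Module.Projective R H := Module.Projective.of_split e π (LinearMap.ext hπ)
  set T := activeCoords e W
  let θ : H →ₗ[R] H :=
    π ∘ₗ (Finsupp.supported R R T).subtype ∘ₗ Finsupp.restrictDom R R T ∘ₗ e
  have hmem : ∀ h, (θ h : F) ∈ W := fun h => by
    have hle : Finsupp.supported R R T ≤ W.comap (H.subtype ∘ₗ π) := by
      rw [Finsupp.supported_eq_span_single, Submodule.span_le]
      rintro _ ⟨j, hj, rfl⟩
      exact hW j hj
    exact hle (Finsupp.restrictDom R R T (e h)).2
  have hfix : ∀ h : H, (h : F) ∈ W → θ h = h := fun h hh => by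
    have he : e h ∈ Finsupp.supported R R T := by
      rw [Finsupp.mem_supported]
      exact fun j hj => ⟨h, hh, by simpa using hj⟩
    have : ((Finsupp.restrictDom R R T (e h) : Finsupp.supported R R T) : Y →₀ R) = e h :=
      congrArg Subtype.val (LinearMap.congr_fun (Finsupp.restrictDom_comp_subtype (M := R)
        (R := R) T) ⟨e h, he⟩)
    change π (Finsupp.restrictDom R R T (e h) : Finsupp.supported R R T) = h
    rw [this, hπ h]
  have := projective_ker_of_idempotent θ fun h => hfix _ (hmem h)
  refine projective_of_range_eq ((H.subtype ∘ₗ (LinearMap.ker θ).subtype).coprod W.subtype) ?_ ?_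
  · rw [← LinearMap.ker_eq_bot, LinearMap.ker_eq_bot']
    rintro ⟨⟨k, hk⟩, w⟩ h
    have h : (k : F) + w = 0 := by simpa using h
    have hkW : (k : F) ∈ W := by
      rw [eq_neg_of_add_eq_zero_left h]
      exact W.neg_mem w.2
    have hk0 : k = 0 := by rw [← hfix k hkW, LinearMap.mem_ker.1 hk]
    subst hk0
    have hw : (w : F) = 0 := by simpa using h
    ext <;> simp [hw]
  · rw [LinearMap.range_coprod, Submodule.range_subtype]
    refine le_antisymm (sup_le_sup_right ?_ _) (sup_le (fun x hx => ?_) le_sup_right)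
    · rintro _ ⟨k, rfl⟩
      exact k.1.2
    · have : x = ((⟨x, hx⟩ - θ ⟨x, hx⟩ : H) : F) + θ ⟨x, hx⟩ := by simp
      rw [this]
      refine Submodule.add_mem_sup ⟨⟨⟨x, hx⟩ - θ ⟨x, hx⟩, ?_⟩, rfl⟩ (hmem _)
      rw [LinearMap.mem_ker, map_sub, hfix _ (hmem _), sub_self]

variable [IsDomain R]

/-- Fix `h₀` in `H ∩ (W + Rx)` outside `W`, with `x`-coefficient `c ≠ 0`. If `h` has coefficient
`d`, then `c • h - d • h₀` lies in `W`, so any newly active coordinate lies in the support of `e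
h₀`. -/
theorem finite_activeCoords_sup_span_diff (e : H →ₗ[R] Y →₀ R) (W : Submodule R F) (x : F) :
    (activeCoords e (W ⊔ R ∙ x) \ activeCoords e W).Finite := by
  by_cases hsub : ∀ h : H, (h : F) ∈ W ⊔ R ∙ x → (h : F) ∈ W
  · refine Set.Finite.subset Set.finite_empty ?_
    rintro j ⟨⟨h, hh, hj⟩, hn⟩
    exact hn ⟨h, hsub h hh, hj⟩
  push Not at hsub
  obtain ⟨h₀, h₀mem, h₀W⟩ := hsub
  obtain ⟨w₀, hw₀, _, hy₀, h₀eq⟩ := Submodule.mem_sup.1 h₀mem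
  obtain ⟨c, rfl⟩ := Submodule.mem_span_singleton.1 hy₀
  have hc : c ≠ 0 := by
    rintro rfl
    exact h₀W (by rw [← h₀eq]; simpa using hw₀)
  refine (e h₀).support.finite_toSet.subset ?_
  rintro j ⟨⟨h, hh, hj⟩, hn⟩
  obtain ⟨w, hw, _, hy, heq⟩ := Submodule.mem_sup.1 hh
  obtain ⟨d, rfl⟩ := Submodule.mem_span_singleton.1 hy
  by_contra hj₀
  have hj₀ : e h₀ j = 0 := by simpa using hj₀
  refine hn ⟨c • h - d • h₀, ?_, ?_⟩
  · have : ((c • h - d • h₀ : H) : F) = c • w - d • w₀ := by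
      simp only [Submodule.coe_sub, Submodule.coe_smul, ← heq, ← h₀eq, smul_add]
      rw [smul_comm d c x]
      abel
    rw [this]
    exact W.sub_mem (W.smul_mem _ hw) (W.smul_mem _ hw₀)
  · simp [hj₀, hc, hj]

theorem finite_activeCoords_sup_span_finset_diff (e : H →ₗ[R] Y →₀ R) (W : Submodule R F)
    (Z : Finset F) :
    (activeCoords e (W ⊔ Submodule.span R (Z : Set F)) \ activeCoords e W).Finite := by
  classical
  induction Z using Finset.induction_on with
  | empty => simp
  | insert x Z hx ih =>
    have := finite_activeCoords_sup_span_diff e (W ⊔ Submodule.span R (Z : Set F)) x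
    refine (this.union ih).subset ?_
    rw [Finset.coe_insert, Submodule.span_insert, sup_comm (R ∙ x), ← sup_assoc]
    rintro j ⟨hj, hn⟩
    by_cases h : j ∈ activeCoords e (W ⊔ Submodule.span R (Z : Set F))
    exacts [Or.inr ⟨h, hn⟩, Or.inl ⟨hj, h⟩]

end Saturation

/-! ### Extension from a projective submodule to the free module -/

section Free

variable {R : Type*} [CommRing R] {X Y : Type*} {H : Submodule R (X →₀ R)}

/-- A union of a directed family of saturated coordinate submodules is saturated. -/
theorem isSaturated_sUnion {e : H →ₗ[R] Y →₀ R} {π : (Y →₀ R) →ₗ[R] H} {c : Set (Set X)}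
    (hne : c.Nonempty) (hdir : DirectedOn (· ⊆ ·) c)
    (hc : ∀ S ∈ c, IsSaturated e π (Finsupp.supported R R S)) :
    IsSaturated e π (Finsupp.supported R R (⋃₀ c)) := by
  rintro j ⟨h, hh, hj⟩
  obtain ⟨S, hS, hn⟩ := hdir.exists_mem_subset_of_finite_of_subset_sUnion hne
    (h : X →₀ R).support.finite_toSet hh
  exact Finsupp.supported_mono (Set.subset_sUnion_of_mem hS) (hc S hS j ⟨h, hn, hj⟩)

/-- Any index can be added to a saturated set of indices at the cost of countably many others. -/
theorem exists_countable_saturated [IsDomain R] (e : H →ₗ[R] Y →₀ R) (π : (Y →₀ R) →ₗ[R] H) {S : Set X}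
    (hS : IsSaturated e π (Finsupp.supported R R S)) (x : X) :
    ∃ Z : Set X, Z.Countable ∧ x ∈ Z ∧ IsSaturated e π (Finsupp.supported R R (S ∪ Z)) := by
  classical
  have hfin : ∀ Z : Finset X, (activeCoords e (Finsupp.supported R R (S ∪ Z)) \
      activeCoords e (Finsupp.supported R R S)).Finite := fun Z => by
    have := finite_activeCoords_sup_span_finset_diff e (Finsupp.supported R R S)
      (Z.image fun i => Finsupp.single i 1)
    rwa [Finset.coe_image, ← Finsupp.supported_eq_span_single,
      ← Finsupp.supported_union] at this
  -- Add the supports demanded by the finitely many newly active coordinates; after `ω` rounds every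
  -- demand is met.
  let next : Finset X → Finset X := fun Z =>
    Z ∪ (hfin Z).toFinset.biUnion fun j => (π (Finsupp.single j 1) : X →₀ R).support
  let z : ℕ → Finset X := fun n => next^[n] {x}
  have hz : ∀ n, z (n + 1) = next (z n) := fun n => Function.iterate_succ_apply' next n _
  have hmono : Monotone z := monotone_nat_of_le_succ fun n => by
    rw [hz]
    exact Finset.subset_union_left
  refine ⟨⋃ n, (z n : Set X), Set.countable_iUnion fun n => (z n).countable_toSet,
    Set.mem_iUnion.2 ⟨0, by simp [z]⟩, ?_⟩
  rintro j ⟨h, hh, hj⟩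
  obtain ⟨n, hn⟩ : ∃ n, ((h : X →₀ R).support : Set X) ⊆ S ∪ z n := by
    have hdir : Directed (· ⊆ ·) fun n => S ∪ (z n : Set X) :=
      Monotone.directed_le fun m n hmn =>
        Set.union_subset_union_right S (Finset.coe_subset.2 (hmono hmn))
    refine hdir.exists_mem_subset_of_finset_subset_biUnion ?_
    rw [← Set.union_iUnion]
    exact hh
  by_cases hjS : j ∈ activeCoords e (Finsupp.supported R R S)
  · exact Finsupp.supported_mono Set.subset_union_left (hS j hjS)
  · rw [Finsupp.mem_supported]
    intro i hi
    refine Or.inr (Set.mem_iUnion.2 ⟨n + 1, ?_⟩)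
    rw [hz]
    refine Finset.mem_coe.2 (Finset.mem_union_right _ (Finset.mem_biUnion.2 ⟨j, ?_, hi⟩))
    exact (hfin _).mem_toFinset.2 ⟨⟨h, hn, hj⟩, hjS⟩

variable {V : Type*} [CommRing V] [IsDomain V] [ValuationRing V]
  {E : Type*} [AddCommGroup E] [Module V E]

/-- Over a valuation domain, a map from a projective submodule of a free module to a divisible
module extends to the whole free module. -/
theorem exists_extend_of_divisible (hE : ∀ r : V, r ≠ 0 → ∀ y : E, ∃ x : E, r • x = y)
    (H : Submodule V (X →₀ V)) [hH : Module.Projective V H] (f : H →ₗ[V] E) :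
    ∃ g : (X →₀ V) →ₗ[V] E, ∀ h : H, g h = f h := by
  obtain ⟨e, he⟩ := Module.projective_def.1 hH
  set π := Finsupp.linearCombination V (id : H → H)
  let 𝒮 : Set (Set X × ((X →₀ V) →ₗ.[V] E)) := {q | IsSaturated e π (Finsupp.supported V V q.1) ∧
    q.2.domain = H ⊔ Finsupp.supported V V q.1}
  have hstart : (∅, ⟨H, f⟩) ∈ 𝒮 := by
    refine ⟨?_, by simp⟩
    rintro j ⟨h, hh, hj⟩
    rw [Finsupp.supported_empty, Submodule.mem_bot, ZeroMemClass.coe_eq_zero] at hh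
    simp [hh] at hj
  obtain ⟨⟨S, p⟩, hle, ⟨hS, hp⟩, hmax⟩ := zorn_le_nonempty₀ 𝒮 (fun c hc hchain q₀ hq₀ => by
    have hdir : DirectedOn (· ≤ ·) c := hchain.directedOn
    have hdir₁ : DirectedOn (· ⊆ ·) (Prod.fst '' c) :=
      directedOn_image.2 (hdir.mono fun _ _ h => h.1)
    have hdir₂ : DirectedOn (· ≤ ·) (Prod.snd '' c) :=
      directedOn_image.2 (hdir.mono fun _ _ h => h.2)
    refine ⟨(⋃₀ (Prod.fst '' c), LinearPMap.sSup _ hdir₂), ⟨isSaturated_sUnion ⟨_, q₀, hq₀, rfl⟩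
      hdir₁ ?_, ?_⟩, fun q hq => ⟨Set.subset_sUnion_of_mem ⟨q, hq, rfl⟩,
        LinearPMap.le_sSup hdir₂ ⟨q, hq, rfl⟩⟩⟩
    · rintro _ ⟨q, hq, rfl⟩
      exact (hc hq).1
    · rw [LinearPMap.domain_sSup]
      refine le_antisymm (sSup_le ?_) (sup_le ?_ ?_)
      · rintro _ ⟨_, ⟨q, hq, rfl⟩, rfl⟩
        rw [(hc hq).2]
        have hq' : q.1 ∈ Prod.fst '' c := ⟨q, hq, rfl⟩
        exact sup_le_sup_left (Finsupp.supported_mono (Set.subset_sUnion_of_mem hq')) _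
      · refine le_trans ?_ (le_sSup ⟨q₀.2, ⟨q₀, hq₀, rfl⟩, rfl⟩)
        rw [(hc hq₀).2]
        exact le_sup_left
      · rw [Set.sUnion_eq_iUnion, Finsupp.supported_iUnion]
        refine iSup_le ?_
        rintro ⟨_, q, hq, rfl⟩
        refine le_trans ?_ (le_sSup ⟨q.2, ⟨q, hq, rfl⟩, rfl⟩)
        rw [(hc hq).2]
        exact le_sup_right) _ hstart
  have htop : p.domain = ⊤ := by
    suffices hU : S = Set.univ by rw [hp, hU, Finsupp.supported_univ, sup_top_eq]
    refine Set.eq_univ_of_forall fun x => ?_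
    obtain ⟨Z, hZc, hxZ, hZ⟩ := exists_countable_saturated e π hS x
    obtain ⟨z, rfl⟩ := hZc.exists_eq_range ⟨x, hxZ⟩
    have : Module.Projective V (Finsupp.supported V V S) :=
      Module.Projective.of_equiv (Finsupp.supportedEquivFinsupp S).symm
    -- Saturation of `S` makes the domain of `p` projective, so the countable extension applies;
    -- saturation of `S ∪ Z` returns the result to `𝒮`.
    obtain ⟨q, hpq, hq⟩ := exists_extend_sup_span_range hE p
      (hp ▸ hS.projective_sup he) fun n => Finsupp.single (z n) 1
    refine (hmax (y := (S ∪ Set.range z, q)) ⟨hZ, ?_⟩ ⟨Set.subset_union_left, hpq⟩).1 (Or.inr hxZ)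
    rw [hq, hp, Finsupp.supported_union, Finsupp.supported_eq_span_single V (Set.range z),
      sup_assoc, ← Set.range_comp]
    rfl
  refine ⟨p.toFun ∘ₗ LinearMap.codRestrict p.domain LinearMap.id (by simp [htop]), fun h => ?_⟩
  exact (hle.2.2 (x := h) rfl).symm

end Free

open CategoryTheory

/-! ### Ext, tightness and divisibility -/

section Homological

variable {V : Type u} [CommRing V]

theorem subsingleton_ext_one_of_forall_extend {S : ShortComplex (ModuleCat.{u} V)}
    (hS : S.ShortExact) [Projective S.X₂] (Y : ModuleCat.{u} V)
    (h : ∀ f : S.X₁ ⟶ Y, ∃ g : S.X₂ ⟶ Y, S.f ≫ g = f) :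
    Subsingleton (Abelian.Ext.{u} S.X₃ Y 1) := by
  refine subsingleton_of_forall_eq 0 fun x => ?_
  obtain ⟨y, rfl⟩ := Abelian.Ext.contravariant_sequence_exact₃ hS Y x
    (Abelian.Ext.eq_zero_of_projective _) (add_zero 1)
  obtain ⟨f, rfl⟩ := (Abelian.Ext.mk₀_bijective _ _).2 y
  obtain ⟨g, rfl⟩ := h f
  rw [← Abelian.Ext.mk₀_comp_mk₀, ShortComplex.ShortExact.extClass_comp_assoc]

theorem exists_extend_of_subsingleton_ext_one {S : ShortComplex (ModuleCat.{u} V)}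
    (hS : S.ShortExact) (Y : ModuleCat.{u} V) [Subsingleton (Abelian.Ext.{u} S.X₃ Y 1)]
    (f : S.X₁ ⟶ Y) : ∃ g : S.X₂ ⟶ Y, S.f ≫ g = f := by
  obtain ⟨y, hy⟩ := Abelian.Ext.contravariant_sequence_exact₁ hS Y (Abelian.Ext.mk₀ f)
    (add_zero 1) (Subsingleton.elim _ _)
  obtain ⟨g, rfl⟩ := (Abelian.Ext.mk₀_bijective _ _).2 y
  refine ⟨g, (Abelian.Ext.mk₀_bijective _ _).1 ?_⟩
  rwa [← Abelian.Ext.mk₀_comp_mk₀]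

/-- Dimension shifting; this turns every projective dimension condition below into projectivity of a
kernel. -/
theorem isObject_iff_projective_ker {F C : Type u} [AddCommGroup F] [Module V F]
    [AddCommGroup C] [Module V C] [Module.Projective V F] (q : F →ₗ[V] C)
    (hq : Function.Surjective q) : IsObject V C ↔ Module.Projective V (LinearMap.ker q) := by
  have hF : Projective (ModuleCat.of V F) := (IsProjective.iff_projective F).1 inferInstance
  rw [IsProjective.iff_projective, projective_iff_hasProjectiveDimensionLT_one]
  exact (LinearMap.shortExact_shortComplexKer hq).hasProjectiveDimensionLT_X₃_iff 0 hF

theorem isObject_of_projective (P : Type u) [AddCommGroup P] [Module V P]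
    [Module.Projective V P] : IsObject V P := by
  refine (isObject_iff_projective_ker LinearMap.id Function.surjective_id).2 ?_
  rw [LinearMap.ker_id]
  infer_instance

theorem linearCombination_id_surjective (M : Type u) [AddCommGroup M] [Module V M] :
    Function.Surjective (Finsupp.linearCombination V (id : M → M)) :=
  Finsupp.linearCombination_surjective V Function.surjective_id

theorem exists_extend_of_subsingleton_ext_quotient {B E : Type u} [AddCommGroup B] [Module V B]
    [AddCommGroup E] [Module V E] (A : Submodule V B)
    (h : Subsingleton (Abelian.Ext.{u} (ModuleCat.of V (B ⧸ A)) (ModuleCat.of V E) 1))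
    (φ : A →ₗ[V] E) : ∃ ψ : B →ₗ[V] E, ∀ a : A, ψ (a : B) = φ a := by
  let S : ShortComplex (ModuleCat.{u} V) :=
    ShortComplex.mk (ModuleCat.ofHom A.subtype) (ModuleCat.ofHom A.mkQ) (by ext; simp)
  have hS : S.ShortExact := ModuleCat.shortComplex_shortExact S
    (LinearMap.exact_subtype_mkQ A) A.injective_subtype A.mkQ_surjective
  obtain ⟨g, hg⟩ :=
    @exists_extend_of_subsingleton_ext_one V _ S hS (ModuleCat.of V E) h (ModuleCat.ofHom φ)
  exact ⟨g.hom, fun a => LinearMap.congr_fun (congrArg ModuleCat.Hom.hom hg) a⟩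

variable [IsDomain V]

theorem isObject_quotient_span_singleton (r : V) : IsObject V (V ⧸ V ∙ r) := by
  refine (isObject_iff_projective_ker (V ∙ r).mkQ (V ∙ r).mkQ_surjective).2 ?_
  rw [Submodule.ker_mkQ]
  rcases eq_or_ne r 0 with rfl | hr
  · rw [Submodule.span_zero_singleton]
    infer_instance
  · exact Module.Projective.of_equiv (LinearEquiv.toSpanNonzeroSingleton V V r hr)

variable [ValuationRing V] {E : Type u} [AddCommGroup E] [Module V E]

/-- Cyclic submodules of a module of projective dimension at most `1` over a valuation domain are
tight. -/
theorem isTight_span_singleton (hE : IsObject V E) (y : E) : IsTight (V ∙ y) := by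
  refine ⟨hE, ?_⟩
  set q := Finsupp.linearCombination V (id : E → E) with hq
  have hsurj : Function.Surjective q := linearCombination_id_surjective E
  have := (isObject_iff_projective_ker q hsurj).1 hE
  refine (isObject_iff_projective_ker ((V ∙ y).mkQ ∘ₗ q)
    ((V ∙ y).mkQ_surjective.comp hsurj)).2 ?_
  -- Passing to `E ⧸ Vy` enlarges the projective kernel by a single lift of `y`.
  have hker : LinearMap.ker ((V ∙ y).mkQ ∘ₗ q) =
      LinearMap.ker q ⊔ V ∙ (Finsupp.single y 1 : E →₀ V) := by
    rw [LinearMap.ker_comp, Submodule.ker_mkQ]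
    have : V ∙ y = (V ∙ (Finsupp.single y 1 : E →₀ V)).map q := by
      rw [Submodule.map_span, Set.image_singleton]
      simp [hq]
    rw [this, Submodule.comap_map_eq, sup_comm]
  rw [hker]
  exact (conductor_principal_and_projective_sup _ _).2

theorem isDivisible_of_forall_extend (hE : IsObject V E)
    (h : ∀ (B : Type u) [AddCommGroup B] [Module V B] (A : Submodule V B),
      IsObject V B → IsObject V A → IsTight A → ∀ φ : A →ₗ[V] E, IsMorphism φ →
        ∃ ψ : B →ₗ[V] E, ∀ a : A, ψ (a : B) = φ a) : IsDivisible V E := by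
  intro r hr y
  let ε := LinearEquiv.toSpanNonzeroSingleton V V r hr
  have hV : IsObject V V := isObject_of_projective V
  have : Module.Projective V (V ∙ r) := Module.Projective.of_equiv ε
  have hA : IsObject V (V ∙ r) := isObject_of_projective _
  let φ : (V ∙ r) →ₗ[V] E := LinearMap.toSpanSingleton V E y ∘ₗ ε.symm.toLinearMap
  have hφ : LinearMap.range φ = V ∙ y := by
    rw [LinearMap.range_comp_of_range_eq_top _ ε.symm.range, LinearMap.range_toSpanSingleton]
  obtain ⟨ψ, hψ⟩ := h V (V ∙ r) hV hA ⟨hV, isObject_quotient_span_singleton r⟩ φ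
    ⟨hA, hE, hφ ▸ isTight_span_singleton hE y⟩
  -- `r • ψ 1 = ψ r = φ r = y`.
  refine ⟨ψ 1, ?_⟩
  have h1 : (ε 1 : V) = r := by simp [ε]
  have := hψ (ε 1)
  rw [h1] at this
  rw [← map_smul, smul_eq_mul, mul_one, this]
  simp [φ]

end Homological

theorem subsingleton_ext_one_of_isDivisible {V : Type u} [CommRing V] [IsDomain V]
    [ValuationRing V] {E C : Type u} [AddCommGroup E] [Module V E] [AddCommGroup C] [Module V C]
    (hE : IsDivisible V E) (hC : IsObject V C) :
    Subsingleton (Abelian.Ext.{u} (ModuleCat.of V C) (ModuleCat.of V E) 1) := by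
  set q := Finsupp.linearCombination V (id : C → C)
  have hq : Function.Surjective q := linearCombination_id_surjective C
  have := (isObject_iff_projective_ker q hq).1 hC
  have hF : Projective (ModuleCat.of V (C →₀ V)) := (IsProjective.iff_projective _).1 inferInstance
  refine @subsingleton_ext_one_of_forall_extend V _ q.shortComplexKer
    (LinearMap.shortExact_shortComplexKer hq) hF (ModuleCat.of V E) fun f => ?_
  obtain ⟨g, hg⟩ := exists_extend_of_divisible hE (LinearMap.ker q) f.hom
  exact ⟨ModuleCat.ofHom g, ModuleCat.hom_ext (LinearMap.ext hg)⟩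

end TightModules

theorem mainTheorem1 {V : Type u} [CommRing V] [IsDomain V] [ValuationRing V]
    (E : Type u) [AddCommGroup E] [Module V E] (hE : TightModules.IsObject V E) :
    List.TFAE [
      ∀ (C : Type u) [AddCommGroup C] [Module V C], TightModules.IsObject V C →
        Subsingleton (CategoryTheory.Abelian.Ext.{u} (ModuleCat.of V C) (ModuleCat.of V E) 1),
      ∀ (B : Type u) [AddCommGroup B] [Module V B] (A : Submodule V B),
        TightModules.IsObject V B → TightModules.IsObject V A → TightModules.IsTight A →
        ∀ φ : A →ₗ[V] E, TightModules.IsMorphism φ →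
          ∃ ψ : B →ₗ[V] E, ∀ a : A, ψ (a : B) = φ a,
      TightModules.IsDivisible V E] := by
  tfae_have 1 → 2 := fun h B _ _ A _ _ hA φ _ =>
    TightModules.exists_extend_of_subsingleton_ext_quotient A (h (B ⧸ A) hA.quotient) φ
  tfae_have 2 → 3 := TightModules.isDivisible_of_forall_extend hE
  tfae_have 3 → 1 := fun h C _ _ hC => TightModules.subsingleton_ext_one_of_isDivisible h hC
  tfae_finish
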